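/- Let $K$ be a (commutative) field of characteristic $0$. For $K$-vector spaces $X, F$ let $F[X]_m$ be the space of homogeneous polynomials of degree $m$ from $X$ to $F$, i.e. maps $f : X \to F$ of the form $f(x) = u(x,\dots,x)$ for some $m$-linear map $u : X^m \to F$. Let $F[[X]] = \prod_{m \ge 0} F[X]_m$ be the space of formal series, and put $S(X) = X[[X]]$. For homogeneous $\xi \in X[X]_r$ and $f \in F[X]_m$ with $f(x) = u(x,\dots,x)$, the derivative of $f$ along $\xi$ is the homogeneous polynomial of degree $r+m-1$ $$(\xi . f)(x) = u(\xi(x),x,\dots,x) + u(x,\xi(x),x,\dots,x) + \dots + u(x,\dots,x,\xi(x))$$ (zero if $m = 0$), which does not depend on the choice of $u$; for series $\xi = \sum_r \xi_r \in S(X)$ and $f = \sum_m f_m \in F[[X]]$ one sets $\xi . f = \sum_s \sum_{r+m-1=s} \xi_r . f_m$. With the bracket $[\xi,\eta] = \xi . \eta - \eta . \xi$, $S(X)$ is a Lie algebra over $K$. A formal action of a Lie algebra $A$ on a vector space $X$ is a homomorphism of Lie algebras $A \to S(X)$. Define rational numbers $t_n$ by $\dfrac{T e^T}{e^T - 1}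 = \sum_{n \ge 0} t_n T^n$. For a Lie algebra $B$ over $K$, of any dimension, and $b \in B$, let $d_b \in S(B)$ be the formal series whose homogeneous component of degree $n$ is $y \mapsto t_n (\operatorname{ad} y)^n (b)$, where $(\operatorname{ad} y)(b) = [y,b]$. **Theorem.** For every Lie algebra $B$ over $K$, the linear map $d : B \to S(B)$, $b \mapsto d_b$ (the fundamental action of $B$), is a homomorphism of Lie algebras: $d_{[a,b]} = [d_a, d_b]$ for all $a, b \in B$. In other words, $d$ is a formal action of $B$ on itself. -/

import Mathlib

open Function Finset

noncomputable section

namespace FormalLie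

section Polynomials

variable (K : Type*) [Field K] (X : Type*) [AddCommGroup X] [Module K X]
  (F : Type*) [AddCommGroup F] [Module K F]

/-- The space `F[X]_m` of homogeneous polynomials of degree `m` with variables in `X` and
coefficients in `F`: the maps `f : X → F` of the form `f x = u (x, …, x)` for at least one
`m`-linear map `u : X^m → F`. -/
def HomogPoly (m : ℕ) : Submodule K (X → F) where
  carrier := {f | ∃ u : MultilinearMap K (fun _ : Fin m => X) F, ∀ x, f x = u fun _ => x}
  add_mem' := by
    rintro f g ⟨u, hu⟩ ⟨v, hv⟩
    exact ⟨u + v, fun x => by simp [hu, hv]⟩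
  zero_mem' := ⟨0, fun x => by simp⟩
  smul_mem' := by
    rintro c f ⟨u, hu⟩
    exact ⟨c • u, fun x => by simp [hu]⟩

/-- The space `F[[X]] = ∏ₘ F[X]_m` of formal series with variables in `X` and coefficients
in `F`; the value `f m` is the homogeneous component of degree `m` of `f`. -/
def FormalSeries : Type _ := ∀ m : ℕ, HomogPoly K X F m

instance : AddCommGroup (FormalSeries K X F) :=
  inferInstanceAs (AddCommGroup (∀ m : ℕ, HomogPoly K X F m))

instance : Module K (FormalSeries K X F) :=
  inferInstanceAs (Module K (∀ m : ℕ, HomogPoly K X F m))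

/-- The space `S(X) = X[[X]]` of formal series with variables and coefficients in `X`. -/
abbrev S : Type _ := FormalSeries K X X

end Polynomials

section Derivative

variable {K : Type*} [Field K] {X : Type*} [AddCommGroup X] [Module K X]
  {F : Type*} [AddCommGroup F] [Module K F]

/-- A multilinear map determining the homogeneous polynomial `f`. -/
def polarMap {m : ℕ} (f : HomogPoly K X F m) : MultilinearMap K (fun _ : Fin m => X) F :=
  Classical.choose f.2

theorem polarMap_spec {m : ℕ} (f : HomogPoly K X F m) (x : X) :
    (f : X → F) x = polarMap f fun _ => x :=
  Classical.choose_spec f.2 x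

/-- For `f x = u (x, …, x)`, the sum `u (v, x, …, x) + u (x, v, x, …, x) + ⋯ + u (x, …, x, v)`.
It does not depend on the choice of `u`, see `polyDeriv_eq`. -/
def polyDeriv {m : ℕ} (f : HomogPoly K X F m) (x v : X) : F :=
  ∑ i : Fin m, polarMap f (update (fun _ => x) i v)

theorem exists_polynomial {ι : Type*} [Fintype ι] [DecidableEq ι]
    (u : MultilinearMap K (fun _ : ι => X) F) (φ : F →ₗ[K] K) (x v : X) :
    ∃ p : Polynomial K, (∀ t : K, p.eval t = φ (u fun _ => x + t • v)) ∧
      p.coeff 1 = φ (∑ i, u (update (fun _ => x) i v)) := by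
  refine ⟨Polynomial.C (φ (u fun _ => x)) +
    Polynomial.C (φ (∑ i, u (update (fun _ => x) i v))) * Polynomial.X +
    ∑ s : Finset ι with 2 ≤ #s,
      Polynomial.C (φ (u (s.piecewise (fun _ => v) fun _ => x))) * Polynomial.X ^ #s, ?_, ?_⟩
  · intro t
    have h := u.map_add_eq_map_add_linearDeriv_add (fun _ => x) (fun _ => t • v)
    have h1 : ((fun _ => x) + fun _ => t • v : ι → X) = fun _ => x + t • v := rfl
    have h2 : u.linearDeriv (fun _ => x) (fun _ => t • v) =
        t • ∑ i, u (update (fun _ => x) i v) := by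
      simp [Finset.smul_sum]
    have h3 : ∀ s : Finset ι, u (s.piecewise (fun _ => t • v) fun _ => x) =
        t ^ #s • u (s.piecewise (fun _ => v) fun _ => x) := by
      intro s
      have := u.map_piecewise_smul (fun _ => t) (s.piecewise (fun _ => v) fun _ => x) s
      rw [Finset.prod_const] at this
      rw [← this]
      congr 1
      ext i
      by_cases hi : i ∈ s <;> simp [hi]
    rw [h1, h2] at h
    rw [h]
    simp only [h3, map_add, map_sum, map_smul, smul_eq_mul, Polynomial.eval_add,
      Polynomial.eval_mul, Polynomial.eval_C, Polynomial.eval_X, Polynomial.eval_finsetSum,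
      Polynomial.eval_pow]
    congr 1
    · ring
    · exact Finset.sum_congr rfl fun s _ => mul_comm _ _
  · have h0 : (∑ s : Finset ι with 2 ≤ #s, Polynomial.C
        (φ (u (s.piecewise (fun _ => v) fun _ => x))) * Polynomial.X ^ #s).coeff 1 = 0 := by
      rw [Polynomial.finsetSum_coeff]
      refine Finset.sum_eq_zero fun s hs => ?_
      rw [Polynomial.coeff_C_mul_X_pow, if_neg]
      have := (Finset.mem_filter.1 hs).2
      omega
    rw [Polynomial.coeff_add, Polynomial.coeff_add, h0,
      Polynomial.coeff_C_of_ne_zero one_ne_zero]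
    simp

theorem sum_update_eq [Infinite K] {ι κ : Type*} [Fintype ι] [DecidableEq ι] [Fintype κ]
    [DecidableEq κ] (u : MultilinearMap K (fun _ : ι => X) F)
    (u' : MultilinearMap K (fun _ : κ => X) F) (h : ∀ x, (u fun _ => x) = u' fun _ => x)
    (x v : X) :
    ∑ i, u (update (fun _ => x) i v) = ∑ i, u' (update (fun _ => x) i v) := by
  rw [← sub_eq_zero, ← Module.forall_dual_apply_eq_zero_iff K]
  intro φ
  obtain ⟨p, hp, hp1⟩ := exists_polynomial u φ x v
  obtain ⟨q, hq, hq1⟩ := exists_polynomial u' φ x v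
  have : p = q := Polynomial.funext fun t => by rw [hp, hq, h]
  rw [map_sub, ← hp1, ← hq1, this, sub_self]

/-- The derivative may be computed with any multilinear map determining the polynomial. -/
theorem polyDeriv_eq [Infinite K] {m : ℕ} (f : HomogPoly K X F m) {ι : Type*} [Fintype ι]
    [DecidableEq ι] (u : MultilinearMap K (fun _ : ι => X) F)
    (h : ∀ x, (f : X → F) x = u fun _ => x) (x v : X) :
    polyDeriv f x v = ∑ i, u (update (fun _ => x) i v) :=
  sum_update_eq _ _ (fun x => by rw [← polarMap_spec, h]) x v

theorem polyDeriv_congr [Infinite K] {m n : ℕ} (f : HomogPoly K X F m) (g : HomogPoly K X F n)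
    (h : (f : X → F) = g) (x v : X) : polyDeriv f x v = polyDeriv g x v :=
  polyDeriv_eq f (polarMap g) (fun x => by rw [h, polarMap_spec]) x v

theorem polyDeriv_add_left [Infinite K] {m : ℕ} (f g : HomogPoly K X F m) (x v : X) :
    polyDeriv (f + g) x v = polyDeriv f x v + polyDeriv g x v := by
  rw [polyDeriv_eq (f + g) (polarMap f + polarMap g) (fun x => by
    simp [← polarMap_spec])]
  simp [polyDeriv, Finset.sum_add_distrib]

theorem polyDeriv_smul_left [Infinite K] {m : ℕ} (c : K) (f : HomogPoly K X F m) (x v : X) :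
    polyDeriv (c • f) x v = c • polyDeriv f x v := by
  rw [polyDeriv_eq (c • f) (c • polarMap f) (fun x => by simp [← polarMap_spec])]
  simp [polyDeriv, Finset.smul_sum]

theorem polyDeriv_sum_left [Infinite K] {m : ℕ} {α : Type*} (s : Finset α)
    (f : α → HomogPoly K X F m) (x v : X) :
    polyDeriv (∑ a ∈ s, f a) x v = ∑ a ∈ s, polyDeriv (f a) x v := by
  classical
  induction s using Finset.induction_on with
  | empty =>
    have := polyDeriv_smul_left (0 : K) (0 : HomogPoly K X F m) x v
    simpa using this
  | insert a s ha ih => rw [Finset.sum_insert ha, Finset.sum_insert ha, polyDeriv_add_left, ih]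

theorem polyDeriv_add_right {m : ℕ} (f : HomogPoly K X F m) (x v w : X) :
    polyDeriv f x (v + w) = polyDeriv f x v + polyDeriv f x w := by
  simp [polyDeriv, Finset.sum_add_distrib]

theorem polyDeriv_smul_right {m : ℕ} (f : HomogPoly K X F m) (c : K) (x v : X) :
    polyDeriv f x (c • v) = c • polyDeriv f x v := by
  simp [polyDeriv, Finset.smul_sum]

theorem polyDeriv_sum_right {m : ℕ} {α : Type*} (s : Finset α) (f : HomogPoly K X F m) (x : X)
    (v : α → X) : polyDeriv f x (∑ a ∈ s, v a) = ∑ a ∈ s, polyDeriv f x (v a) := by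
  classical
  induction s using Finset.induction_on with
  | empty => simpa using polyDeriv_smul_right f (0 : K) x 0
  | insert a s ha ih => rw [Finset.sum_insert ha, Finset.sum_insert ha, polyDeriv_add_right, ih]

theorem polyDeriv_degree_zero (f : HomogPoly K X F 0) (x v : X) : polyDeriv f x v = 0 := by
  simp [polyDeriv]

theorem id_mem : (fun x => x : X → X) ∈ HomogPoly K X X 1 :=
  ⟨MultilinearMap.ofSubsingleton K X X (0 : Fin 1) LinearMap.id, fun x => by simp⟩

theorem polyDeriv_id [Infinite K] (x v : X) :
    polyDeriv (⟨fun x => x, id_mem⟩ : HomogPoly K X X 1) x v = v := by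
  rw [polyDeriv_eq _ (MultilinearMap.ofSubsingleton K X X (0 : Fin 1) LinearMap.id)
    (fun x => by simp)]
  simp

/-- The composite of a multilinear map with homogeneous polynomials. -/
def compMap {m : ℕ} (u : MultilinearMap K (fun _ : Fin m => X) F) {d : Fin m → ℕ}
    (φ : ∀ j, HomogPoly K X X (d j)) : MultilinearMap K (fun _ : (Σ j, Fin (d j)) => X) F :=
  u.compMultilinearMap (N := fun (j : Fin m) (_ : Fin (d j)) => X) fun j => polarMap (φ j)

theorem compMap_diag {m : ℕ} (u : MultilinearMap K (fun _ : Fin m => X) F) {d : Fin m → ℕ}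
    (φ : ∀ j, HomogPoly K X X (d j)) (x : X) :
    (compMap u φ fun _ => x) = u fun j => (φ j : X → X) x := by
  simp only [polarMap_spec]
  rfl

theorem comp_mem {m s : ℕ} (u : MultilinearMap K (fun _ : Fin m => X) F) {d : Fin m → ℕ}
    (φ : ∀ j, HomogPoly K X X (d j)) (hs : ∑ j, d j = s) :
    (fun x => u fun j => (φ j : X → X) x) ∈ HomogPoly K X F s :=
  ⟨(compMap u φ).domDomCongr (Fintype.equivFinOfCardEq (by simp [hs])), fun x => by
    simp [compMap_diag]⟩

theorem polyDeriv_comp [Infinite K] {m s : ℕ} (u : MultilinearMap K (fun _ : Fin m => X) F)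
    {d : Fin m → ℕ} (φ : ∀ j, HomogPoly K X X (d j)) (f : HomogPoly K X F s)
    (hf : ∀ x, (f : X → F) x = u fun j => (φ j : X → X) x) (x v : X) :
    polyDeriv f x v =
      ∑ j, u (update (fun j => (φ j : X → X) x) j (polyDeriv (φ j) x v)) := by
  rw [polyDeriv_eq f (compMap u φ) (fun x => by rw [hf, compMap_diag]), Fintype.sum_sigma]
  refine Finset.sum_congr rfl fun j _ => ?_
  rw [polyDeriv, MultilinearMap.map_update_sum]
  refine Finset.sum_congr rfl fun k _ => ?_
  change u _ = u _
  congr 1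
  ext l
  by_cases h : l = j
  · subst h
    simp only [update_self]
    congr 1
    ext a
    by_cases h : a = k
    · subst h; simp [Sigma.curry]
    · simp [Sigma.curry, h]
  · simp only [update_of_ne h, polarMap_spec]
    congr 1
    ext a
    have : (⟨l, a⟩ : Σ j, Fin (d j)) ≠ ⟨j, k⟩ := fun e => h (congrArg Sigma.fst e)
    simp [Sigma.curry, this]

/-- The polynomial `η` at the place `i`, the identity at all other places. -/
def placeAt {m r : ℕ} (η : HomogPoly K X X r) (i j : Fin m) :
    HomogPoly K X X (if j = i then r else 1) :=
  ⟨if j = i then η else fun x => x, by split_ifs <;> [exact η.2; exact id_mem]⟩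

theorem placeAt_apply {m r : ℕ} (η : HomogPoly K X X r) (i : Fin m) (x : X) :
    (fun j => (placeAt η i j : X → X) x) = update (fun _ => x) i ((η : X → X) x) := by
  ext j
  by_cases h : j = i
  · subst h; simp [placeAt]
  · simp [placeAt, h]

theorem polyDeriv_placeAt [Infinite K] {m r : ℕ} (η : HomogPoly K X X r) (i j : Fin m) (x v : X) :
    polyDeriv (placeAt η i j) x v = if j = i then polyDeriv η x v else v := by
  split_ifs with h
  · exact polyDeriv_congr _ _ (by simp [placeAt, h]) x v
  · exact (polyDeriv_congr _ ⟨fun x => x, id_mem⟩ (by simp [placeAt, h]) x v).trans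
      (polyDeriv_id x v)

theorem sum_place {m r s : ℕ} (i : Fin m) (h : r + m = s + 1) :
    ∑ j : Fin m, (if j = i then r else 1) = s := by
  have := Finset.add_sum_erase univ (fun j : Fin m => if j = i then r else 1) (mem_univ i)
  have h2 : ∑ j ∈ univ.erase i, (if j = i then r else 1) = m - 1 := by
    rw [Finset.sum_congr rfl (g := fun _ => 1) (fun j hj => by simp [Finset.ne_of_mem_erase hj])]
    simp
  have := i.pos
  simp only [if_true] at *
  omega

theorem place_mem {m r s : ℕ} (u : MultilinearMap K (fun _ : Fin m => X) F)
    (η : HomogPoly K X X r) (i : Fin m) (h : r + m = s + 1) :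
    (fun x => u (update (fun _ => x) i ((η : X → X) x))) ∈ HomogPoly K X F s := by
  simp only [← placeAt_apply]
  exact comp_mem u (placeAt η i) (sum_place i h)

/-- The derivative `ξ.f` of the homogeneous polynomial `f` along the homogeneous polynomial `ξ`:
`(ξ.f)(x) = u (ξ x, x, …, x) + ⋯ + u (x, …, x, ξ x)`. -/
def homogDeriv {r m : ℕ} (ξ : HomogPoly K X X r) (f : HomogPoly K X F m) : X → F :=
  fun x => polyDeriv f x ((ξ : X → X) x)

theorem homogDeriv_mem {r m s : ℕ} (ξ : HomogPoly K X X r) (f : HomogPoly K X F m)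
    (h : r + m = s + 1) : homogDeriv ξ f ∈ HomogPoly K X F s := by
  have : homogDeriv ξ f =
      ∑ i, fun x => polarMap f (update (fun _ => x) i ((ξ : X → X) x)) := by
    ext x; simp [homogDeriv, polyDeriv]
  rw [this]
  exact Submodule.sum_mem _ fun i _ => place_mem _ ξ i h

/-- The derivative `ξ.f` of the formal series `f` along the formal series `ξ`: its homogeneous
component of degree `s` is `∑ ξ_r.f_m` over all `r, m` with `r + m - 1 = s`. -/
def formalDeriv (ξ : S K X) (f : FormalSeries K X F) : FormalSeries K X F := fun s =>
  ⟨∑ p ∈ antidiagonal (s + 1), homogDeriv (ξ p.1) (f p.2),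
    Submodule.sum_mem _ fun _ hp => homogDeriv_mem _ _ (mem_antidiagonal.1 hp)⟩

/-- The bracket `[ξ, η] = ξ.η - η.ξ` of `S(X)`. -/
instance : Bracket (S K X) (S K X) := ⟨fun ξ η => formalDeriv ξ η - formalDeriv η ξ⟩

theorem lie_def (ξ η : S K X) : ⁅ξ, η⁆ = formalDeriv ξ η - formalDeriv η ξ := rfl

theorem series_ext {f g : FormalSeries K X F}
    (h : ∀ s x, (f s : X → F) x = (g s : X → F) x) : f = g :=
  funext fun s => Subtype.ext (funext (h s))

theorem formalDeriv_apply (ξ : S K X) (f : FormalSeries K X F) (s : ℕ) (x : X) :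
    (formalDeriv ξ f s : X → F) x =
      ∑ p ∈ antidiagonal (s + 1), polyDeriv (f p.2) x ((ξ p.1 : X → X) x) := by
  simp [formalDeriv, homogDeriv]

theorem series_add_apply (f g : FormalSeries K X F) (s : ℕ) : (f + g) s = f s + g s := rfl

theorem series_sub_apply (f g : FormalSeries K X F) (s : ℕ) : (f - g) s = f s - g s := rfl

theorem series_smul_apply (c : K) (f : FormalSeries K X F) (s : ℕ) : (c • f) s = c • f s := rfl

theorem formalDeriv_add_left (ξ η : S K X) (f : FormalSeries K X F) :
    formalDeriv (ξ + η) f = formalDeriv ξ f + formalDeriv η f :=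
  series_ext fun s x => by
    simp [series_add_apply, formalDeriv_apply, polyDeriv_add_right, Finset.sum_add_distrib]

theorem formalDeriv_smul_left (c : K) (ξ : S K X) (f : FormalSeries K X F) :
    formalDeriv (c • ξ) f = c • formalDeriv ξ f :=
  series_ext fun s x => by
    simp [series_smul_apply, formalDeriv_apply, polyDeriv_smul_right, Finset.smul_sum]

theorem formalDeriv_sub_left (ξ η : S K X) (f : FormalSeries K X F) :
    formalDeriv (ξ - η) f = formalDeriv ξ f - formalDeriv η f := by
  rw [eq_sub_iff_add_eq, ← formalDeriv_add_left, sub_add_cancel]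

/-- The second derivative of a homogeneous polynomial. -/
def secondDeriv {m : ℕ} (f : HomogPoly K X F m) (x v w : X) : F :=
  ∑ i : Fin m, ∑ j ∈ univ.erase i, polarMap f (update (update (fun _ => x) i v) j w)

theorem secondDeriv_symm {m : ℕ} (f : HomogPoly K X F m) (x v w : X) :
    secondDeriv f x v w = secondDeriv f x w v := by
  unfold secondDeriv
  rw [Finset.sum_comm' (t' := univ) (s' := fun j => univ.erase j) (by simp [eq_comm])]
  refine Finset.sum_congr rfl fun j _ => Finset.sum_congr rfl fun i hi => ?_
  rw [update_comm (Finset.ne_of_mem_erase hi)]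

variable [Infinite K]

theorem formalDeriv_add_right (ξ : S K X) (f g : FormalSeries K X F) :
    formalDeriv ξ (f + g) = formalDeriv ξ f + formalDeriv ξ g :=
  series_ext fun s x => by
    simp [series_add_apply, formalDeriv_apply, polyDeriv_add_left, Finset.sum_add_distrib]

theorem formalDeriv_smul_right (c : K) (ξ : S K X) (f : FormalSeries K X F) :
    formalDeriv ξ (c • f) = c • formalDeriv ξ f :=
  series_ext fun s x => by
    simp [series_smul_apply, formalDeriv_apply, polyDeriv_smul_left, Finset.smul_sum]

theorem formalDeriv_sub_right (ξ : S K X) (f g : FormalSeries K X F) :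
    formalDeriv ξ (f - g) = formalDeriv ξ f - formalDeriv ξ g := by
  rw [eq_sub_iff_add_eq, ← formalDeriv_add_right, sub_add_cancel]

theorem polyDeriv_homogDeriv {r m s : ℕ} (η : HomogPoly K X X r) (f : HomogPoly K X F m)
    (h : r + m = s + 1) (x v : X) :
    polyDeriv (⟨homogDeriv η f, homogDeriv_mem η f h⟩ : HomogPoly K X F s) x v =
      polyDeriv f x (polyDeriv η x v) + secondDeriv f x ((η : X → X) x) v := by
  have : (⟨homogDeriv η f, homogDeriv_mem η f h⟩ : HomogPoly K X F s) =
      ∑ i, ⟨_, place_mem (polarMap f) η i h⟩ := by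
    ext x; simp [homogDeriv, polyDeriv]
  rw [this, polyDeriv_sum_left, polyDeriv, secondDeriv, ← Finset.sum_add_distrib]
  refine Finset.sum_congr rfl fun i _ => ?_
  rw [polyDeriv_comp (polarMap f) (placeAt η i) _ (fun x => by rw [placeAt_apply]),
    ← Finset.add_sum_erase univ _ (mem_univ i)]
  simp only [placeAt_apply, polyDeriv_placeAt, if_true, update_idem]
  congr 1
  exact Finset.sum_congr rfl fun j hj => by rw [if_neg (Finset.ne_of_mem_erase hj)]

theorem sum_antidiagonal_assoc (G : ℕ → ℕ → ℕ → F) (n : ℕ) :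
    ∑ p ∈ antidiagonal n, ∑ q ∈ antidiagonal p.2, G p.1 q.1 q.2 =
      ∑ p ∈ antidiagonal n, ∑ q ∈ antidiagonal p.1, G q.1 q.2 p.2 := by
  rw [Finset.sum_sigma', Finset.sum_sigma']
  refine Finset.sum_nbij' (fun a => ⟨(a.1.1 + a.2.1, a.2.2), (a.1.1, a.2.1)⟩)
    (fun a => ⟨(a.2.1, a.2.2 + a.1.2), (a.2.2, a.1.2)⟩) ?_ ?_ ?_ ?_ ?_
  · rintro ⟨⟨a, b⟩, ⟨c, d⟩⟩ h
    simp only [mem_sigma, HasAntidiagonal.mem_antidiagonal] at h ⊢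
    obtain ⟨rfl, rfl⟩ := h
    simp [add_assoc]
  · rintro ⟨⟨a, b⟩, ⟨c, d⟩⟩ h
    simp only [mem_sigma, HasAntidiagonal.mem_antidiagonal] at h ⊢
    obtain ⟨rfl, rfl⟩ := h
    simp [add_assoc]
  · rintro ⟨⟨a, b⟩, ⟨c, d⟩⟩ h
    simp only [mem_sigma, HasAntidiagonal.mem_antidiagonal] at h
    obtain ⟨rfl, rfl⟩ := h
    rfl
  · rintro ⟨⟨a, b⟩, ⟨c, d⟩⟩ h
    simp only [mem_sigma, HasAntidiagonal.mem_antidiagonal] at h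
    obtain ⟨rfl, rfl⟩ := h
    rfl
  · intro a _
    rfl

theorem sum_antidiagonal_right (G : ℕ → ℕ → ℕ → F) (s : ℕ) (h : G (s + 2) 0 0 = 0) :
    ∑ p ∈ antidiagonal (s + 1), ∑ q ∈ antidiagonal (p.2 + 1), G p.1 q.1 q.2 =
      ∑ p ∈ antidiagonal (s + 2), ∑ q ∈ antidiagonal p.2, G p.1 q.1 q.2 := by
  rw [Finset.Nat.sum_antidiagonal_succ' (n := s + 1)]
  simp [h]

theorem sum_antidiagonal_left (G : ℕ → ℕ → ℕ → F) (s : ℕ) (h : G 0 0 (s + 2) = 0) :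
    ∑ p ∈ antidiagonal (s + 1), ∑ q ∈ antidiagonal (p.1 + 1), G q.1 q.2 p.2 =
      ∑ p ∈ antidiagonal (s + 2), ∑ q ∈ antidiagonal p.1, G q.1 q.2 p.2 := by
  rw [Finset.Nat.sum_antidiagonal_succ (n := s + 1)]
  simp [h]

theorem formalDeriv_formalDeriv (ξ η : S K X) (f : FormalSeries K X F) (s : ℕ) (x : X) :
    (formalDeriv ξ (formalDeriv η f) s : X → F) x =
      (formalDeriv (formalDeriv ξ η) f s : X → F) x +
      ∑ p ∈ antidiagonal (s + 2), ∑ q ∈ antidiagonal p.1,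
        secondDeriv (f p.2) x ((ξ q.1 : X → X) x) ((η q.2 : X → X) x) := by
  have h1 : ∀ (n : ℕ) (v : X), polyDeriv (formalDeriv η f n) x v =
      ∑ q ∈ antidiagonal (n + 1), (polyDeriv (f q.2) x (polyDeriv (η q.1) x v) +
        secondDeriv (f q.2) x ((η q.1 : X → X) x) v) := by
    intro n v
    have : formalDeriv η f n = ∑ q ∈ (antidiagonal (n + 1)).attach,
        ⟨homogDeriv (η q.1.1) (f q.1.2), homogDeriv_mem _ _ (mem_antidiagonal.1 q.2)⟩ := by
      ext y
      rw [formalDeriv_apply, ← Finset.sum_attach]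
      simp [homogDeriv]
    rw [this, polyDeriv_sum_left, ← Finset.sum_attach (antidiagonal (n + 1))]
    exact Finset.sum_congr rfl fun q _ =>
      polyDeriv_homogDeriv _ _ (mem_antidiagonal.1 q.2) _ _
  rw [formalDeriv_apply, formalDeriv_apply]
  simp only [h1, formalDeriv_apply, polyDeriv_sum_right]
  rw [sum_antidiagonal_right (fun r q m =>
      polyDeriv (f m) x (polyDeriv (η q) x ((ξ r : X → X) x)) +
        secondDeriv (f m) x ((η q : X → X) x) ((ξ r : X → X) x)) s
      (by simp [polyDeriv_degree_zero, secondDeriv]),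
    sum_antidiagonal_left (fun r q m =>
      polyDeriv (f m) x (polyDeriv (η q) x ((ξ r : X → X) x))) s
      (by simpa [polyDeriv_degree_zero] using polyDeriv_smul_right (f (s + 2)) (0 : K) x 0),
    sum_antidiagonal_assoc (fun r q m =>
      polyDeriv (f m) x (polyDeriv (η q) x ((ξ r : X → X) x)) +
        secondDeriv (f m) x ((η q : X → X) x) ((ξ r : X → X) x)),
    ← Finset.sum_add_distrib]
  refine Finset.sum_congr rfl fun p _ => ?_
  rw [← Finset.sum_add_distrib]
  exact Finset.sum_congr rfl fun q _ => by rw [secondDeriv_symm]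

/-- `[ξ, η].f = ξ.(η.f) - η.(ξ.f)`. -/
theorem formalDeriv_lie (ξ η : S K X) (f : FormalSeries K X F) :
    formalDeriv ⁅ξ, η⁆ f = formalDeriv ξ (formalDeriv η f) - formalDeriv η (formalDeriv ξ f) := by
  refine series_ext fun s x => ?_
  rw [lie_def, formalDeriv_sub_left]
  simp only [series_sub_apply, Submodule.coe_sub, Pi.sub_apply, formalDeriv_formalDeriv ξ η,
    formalDeriv_formalDeriv η ξ]
  have : ∑ p ∈ antidiagonal (s + 2), ∑ q ∈ antidiagonal p.1,
        secondDeriv (f p.2) x ((ξ q.1 : X → X) x) ((η q.2 : X → X) x) =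
      ∑ p ∈ antidiagonal (s + 2), ∑ q ∈ antidiagonal p.1,
        secondDeriv (f p.2) x ((η q.1 : X → X) x) ((ξ q.2 : X → X) x) := by
    refine Finset.sum_congr rfl fun p _ => ?_
    rw [← Finset.Nat.sum_antidiagonal_swap]
    exact Finset.sum_congr rfl fun q _ => secondDeriv_symm _ _ _ _
  rw [this]
  abel

/-- The Lie algebra `S(X)`. -/
instance : LieRing (S K X) where
  add_lie ξ η ζ := by
    simp only [lie_def, formalDeriv_add_left, formalDeriv_add_right]
    abel
  lie_add ξ η ζ := by
    simp only [lie_def, formalDeriv_add_left, formalDeriv_add_right]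
    abel
  lie_self ξ := sub_self _
  leibniz_lie ξ η ζ := by
    rw [lie_def ξ, lie_def ⁅ξ, η⁆, lie_def η ⁅ξ, ζ⁆, formalDeriv_lie, formalDeriv_lie,
      formalDeriv_lie, lie_def ξ η, lie_def ξ ζ, lie_def η ζ]
    simp only [formalDeriv_sub_right]
    abel

instance : LieAlgebra K (S K X) where
  lie_smul c ξ η := by
    simp only [lie_def, formalDeriv_smul_left, formalDeriv_smul_right, smul_sub]

end Derivative

/-- A formal action of the Lie algebra `A` on the vector space `X` is a homomorphism of Lie
algebras `A → S(X)`. -/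
abbrev FormalAction (K : Type*) [Field K] [Infinite K] (A : Type*) [LieRing A] [LieAlgebra K A]
    (X : Type*) [AddCommGroup X] [Module K X] : Type _ :=
  A →ₗ⁅K⁆ S K X

section Fundamental

/-- The series `G(T) = T e^T / (e^T - 1) = e^T / ((e^T - 1) / T)`, where
`(e^T - 1) / T = ∑ T^n / (n + 1)!`. -/
def G : PowerSeries ℚ :=
  PowerSeries.exp ℚ * (PowerSeries.mk fun n => 1 / ((n + 1).factorial : ℚ))⁻¹

theorem G_mul_exp_sub_one : G * (PowerSeries.exp ℚ - 1) = PowerSeries.X * PowerSeries.exp ℚ := by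
  have h : PowerSeries.exp ℚ - 1 =
      PowerSeries.X * PowerSeries.mk fun n => 1 / ((n + 1).factorial : ℚ) := by
    ext n
    cases n with
    | zero => simp
    | succ n => simp [PowerSeries.coeff_succ_X_mul, PowerSeries.coeff_exp, PowerSeries.coeff_one]
  rw [G, h, mul_left_comm, mul_assoc, PowerSeries.inv_mul_cancel, mul_one]
  simp

/-- The coefficients of `G(T) = ∑ t_n T^n`. -/
def tCoeff (n : ℕ) : ℚ := PowerSeries.coeff n G

variable (K : Type*) [Field K] (B : Type*) [LieRing B] [LieAlgebra K B]

/-- The `n`-linear map `u_{b,n}(y₁, …, yₙ) = t_n (ad y₁ ∘ ⋯ ∘ ad yₙ)(b)`. -/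
def fundamentalMultilinear (b : B) (n : ℕ) : MultilinearMap K (fun _ : Fin n => B) B :=
  (tCoeff n : K) • (LinearMap.applyₗ (R := K) b).compMultilinearMap
    ((MultilinearMap.mkPiAlgebraFin K n (Module.End K B)).compLinearMap
      fun _ => (LieAlgebra.ad K B : B →ₗ[K] Module.End K B))

/-- The homogeneous polynomial `d_{b,n}(y) = t_n (ad y)^n (b)`, determined by `u_{b,n}`. -/
def fundamentalComponent (b : B) (n : ℕ) : HomogPoly K B B n :=
  ⟨fun y => (tCoeff n : K) • ((LieAlgebra.ad K B y) ^ n) b,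
    fundamentalMultilinear K B b n, fun y => by simp [fundamentalMultilinear]⟩

/-- The formal series `d_b = ∑ d_{b,n}`, that is `d_b(y) = ∑ t_n (ad y)^n (b)`. -/
def fundamentalSeries (b : B) : S K B := fun n => fundamentalComponent K B b n

/-- The fundamental action `d : B → S(B)`, `b ↦ d_b`, as a linear map. -/
def fundamentalAction [CharZero K] : B →ₗ[K] S K B where
  toFun := fundamentalSeries K B
  map_add' a b := series_ext fun n y => by
    rw [series_add_apply]
    simp [fundamentalSeries, fundamentalComponent]
  map_smul' c b := series_ext fun n y => by
    rw [RingHom.id_apply, series_smul_apply]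
    simp [fundamentalSeries, fundamentalComponent, smul_comm c]

end Fundamental

end FormalLie

end

/-! Fix `y` and encode `[(ad y)^p a, (ad y)^q b]` as the monomial `S^p T^q`. By the Leibniz rule,
applying `ad y` to such a bracket is multiplication by `S + T`. Differentiating `t_q (ad y)^q b`
along `t_p (ad y)^p a` puts the latter in each of the `q` slots in turn, which encodes as `t_p t_q
S^p ∑ (S + T)^i T^(q-1-i)`. The opposite derivative gives the same with `S` and `T` exchanged and a
minus sign from antisymmetry, so the bracket of the two series becomes a sum.

The theorem thus reduces to an identity of polynomials in two commuting variables, independent of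
`B`: the sum of these terms over `p + q = n + 1` must be `t_n (S + T)^n`, the code of `t_n (ad y)^n
[a, b]`. After multiplication by `S T` the geometric sums become differences of powers, and the
identity is the coefficient of `Z^(n+1)` in a functional equation relating `G(SZ)`, `G(TZ)` and
`G((S+T)Z)`. That equation follows from `G(Z)(e^Z - 1) = Z e^Z` and `e^(SZ) e^(TZ) = e^((S+T)Z)`;
see `rescaledG_functional_equation` and `sum_antidiagonal_tCoeff`. -/

namespace FormalLie

open MvPolynomial

/-! ### Encoding brackets of iterated adjoints by polynomials in two variables -/

section LieEval

variable {K : Type*} [Field K] {B : Type*} [LieRing B] [LieAlgebra K B]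

/-- The linear map `K[S, T] → B` that sends `S^p T^q` to `[(ad y)^p a, (ad y)^q b]`. -/
noncomputable def lieEval (y a b : B) : MvPolynomial (Fin 2) K →ₗ[K] B :=
  (MvPolynomial.basisMonomials (Fin 2) K).constr K fun m =>
    ⁅((LieAlgebra.ad K B y) ^ m 0) a, ((LieAlgebra.ad K B y) ^ m 1) b⁆

theorem lieEval_monomial (y a b : B) (m : Fin 2 →₀ ℕ) :
    lieEval y a b (monomial m (1 : K)) =
      ⁅((LieAlgebra.ad K B y) ^ m 0) a, ((LieAlgebra.ad K B y) ^ m 1) b⁆ := by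
  rw [lieEval, ← congrFun (coe_basisMonomials (Fin 2) K) m, Module.Basis.constr_basis]

theorem lieEval_X_pow_mul_X_pow (y a b : B) (p q : ℕ) :
    lieEval y a b (X 0 ^ p * X 1 ^ q : MvPolynomial (Fin 2) K) =
      ⁅((LieAlgebra.ad K B y) ^ p) a, ((LieAlgebra.ad K B y) ^ q) b⁆ := by
  rw [X_pow_eq_monomial, X_pow_eq_monomial, monomial_mul, one_mul, lieEval_monomial]
  simp

/-- The Leibniz rule for `ad y`: it raises the exponent of `S` in one term and that of `T` in the
other. -/
theorem lieEval_add_mul (y a b : B) (P : MvPolynomial (Fin 2) K) :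
    lieEval y a b ((X 0 + X 1) * P) = LieAlgebra.ad K B y (lieEval y a b P) := by
  suffices (lieEval y a b).comp (LinearMap.mulLeft K (X 0 + X 1 : MvPolynomial (Fin 2) K)) =
      (LieAlgebra.ad K B y).comp (lieEval y a b) from LinearMap.congr_fun this P
  refine (MvPolynomial.basisMonomials (Fin 2) K).ext fun m => ?_
  simp only [coe_basisMonomials, LinearMap.comp_apply, LinearMap.mulLeft_apply, add_mul, map_add,
    X, monomial_mul, one_mul, lieEval_monomial, LieAlgebra.ad_apply]
  rw [leibniz_lie]
  simp [pow_succ', add_comm _ (m _)]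

theorem lieEval_add_pow_mul (y a b : B) (n : ℕ) (P : MvPolynomial (Fin 2) K) :
    lieEval y a b ((X 0 + X 1) ^ n * P) = (LieAlgebra.ad K B y ^ n) (lieEval y a b P) := by
  induction n with
  | zero => simp
  | succ n ih => rw [pow_succ', mul_assoc, lieEval_add_mul, ih, pow_succ', Module.End.mul_apply]

/-- The code `Ψ` is kept abstract so that one computation serves both derivatives, with the roles of
the two variables exchanged and `Ψ` negated. Here `σ` encodes `ad y`, `w` encodes `ad y` acting on
`b` alone, and `c` encodes the inserted vector `v`. -/
theorem sum_fundamentalMultilinear_update {R : Type*} [CommRing R] [Module K R] (y v b : B)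
    (Ψ : R →ₗ[K] B) (c σ w : R) (hΨ : ∀ P, Ψ (σ * P) = ⁅y, Ψ P⁆)
    (h : ∀ j, Ψ (c * w ^ j) = ⁅v, ((LieAlgebra.ad K B y) ^ j) b⁆) (m : ℕ) :
    ∑ i, fundamentalMultilinear K B b m (update (fun _ => y) i v) =
      (tCoeff m : K) • Ψ (c * ∑ i ∈ range m, σ ^ i * w ^ (m - 1 - i)) := by
  simp only [fundamentalMultilinear, _root_.smul_apply, ← Finset.smul_sum]
  congr 1
  have key : ∀ m : ℕ, ∑ i : Fin m, (List.ofFn fun j => LieAlgebra.ad K B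
      (update (fun _ : Fin m => y) i v j)).prod b =
      Ψ (c * ∑ i ∈ range m, σ ^ i * w ^ (m - 1 - i)) := by
    intro m
    -- The outermost factor is split off: `v` in the first slot gives `c * w ^ m`, and `y` there
    -- gives `σ` times the sum for `m`.
    induction m with
    | zero => simp
    | succ m ih =>
      have hQ : c * ∑ i ∈ range (m + 1), σ ^ i * w ^ (m + 1 - 1 - i) =
          c * w ^ m + σ * (c * ∑ i ∈ range m, σ ^ i * w ^ (m - 1 - i)) := by
        rw [Finset.sum_range_succ', mul_left_comm, ← mul_add, Finset.mul_sum, add_comm]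
        congr 2
        · simp
        · refine Finset.sum_congr rfl fun i _ => ?_
          rw [pow_succ', mul_assoc, show m + 1 - 1 - (i + 1) = m - 1 - i by omega]
      rw [hQ, map_add, hΨ, h, ← ih, Fin.sum_univ_succ, lie_sum]
      congr 1
      · simp [List.ofFn_succ]
      · refine Finset.sum_congr rfl fun i _ => ?_
        have hu : ∀ j : Fin m, update (fun _ : Fin (m + 1) => y) i.succ v j.succ =
            update (fun _ : Fin m => y) i v j := fun j => by
          by_cases hj : j = i
          · subst hj; simp
          · simp [hj]
        simp [List.ofFn_succ, hu, (Fin.succ_ne_zero i).symm]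
  rw [← key]
  rfl

theorem polyDeriv_fundamentalComponent [Infinite K] {R : Type*} [CommRing R] [Module K R]
    (y v b : B) (Ψ : R →ₗ[K] B) (c σ w : R) (hΨ : ∀ P, Ψ (σ * P) = ⁅y, Ψ P⁆)
    (h : ∀ j, Ψ (c * w ^ j) = ⁅v, ((LieAlgebra.ad K B y) ^ j) b⁆) (m : ℕ) :
    polyDeriv (fundamentalComponent K B b m) y v =
      (tCoeff m : K) • Ψ (c * ∑ i ∈ range m, σ ^ i * w ^ (m - 1 - i)) := by
  rw [polyDeriv_eq _ (fundamentalMultilinear K B b m)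
    (fun x => by simp [fundamentalComponent, fundamentalMultilinear]),
    sum_fundamentalMultilinear_update y v b Ψ c σ w hΨ h]

end LieEval

/-! ### The functional equation of `G` and its coefficients -/

section FunctionalEquation

variable {R : Type*} [CommRing R] [Algebra ℚ R]

/-- The series `G(s Z) = ∑ t_n s^n Z^n`. -/
noncomputable def rescaledG (s : R) : PowerSeries R :=
  PowerSeries.rescale s (PowerSeries.map (algebraMap ℚ R) G)

theorem coeff_rescaledG (s : R) (n : ℕ) :
    PowerSeries.coeff n (rescaledG s) = s ^ n * algebraMap ℚ R (tCoeff n) := by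
  simp [rescaledG, PowerSeries.coeff_rescale, tCoeff]

theorem rescaledG_mul (s : R) :
    rescaledG s * (PowerSeries.rescale s (PowerSeries.exp R) - 1) =
      PowerSeries.C s * PowerSeries.X * PowerSeries.rescale s (PowerSeries.exp R) := by
  have h := congrArg (fun f => PowerSeries.rescale s (PowerSeries.map (algebraMap ℚ R) f))
    G_mul_exp_sub_one
  simpa [rescaledG, PowerSeries.rescale_X] using h

/-- The coefficient of degree one is `s`. -/
theorem rescale_exp_sub_one_ne_zero {s : R} (hs : s ≠ 0) :
    PowerSeries.rescale s (PowerSeries.exp R) - 1 ≠ 0 := fun h => hs <| by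
  simpa [PowerSeries.coeff_rescale, PowerSeries.coeff_exp, PowerSeries.coeff_one] using
    congrArg (PowerSeries.coeff 1) h

/-- With `u = e^(sZ)` and `v = e^(tZ)`, each `G` is a fraction with denominator `u - 1`, `v - 1` or
`uv - 1`. In a domain these nonzero denominators can be cleared, leaving a polynomial identity. -/
theorem rescaledG_functional_equation [IsDomain R] {s t : R} (hs : s ≠ 0) (ht : t ≠ 0)
    (hst : s + t ≠ 0) :
    PowerSeries.C t * (rescaledG s * (rescaledG (s + t) - rescaledG t)) +
      PowerSeries.C s * (rescaledG t * (rescaledG (s + t) - rescaledG s)) =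
      PowerSeries.X * PowerSeries.C (s * t) * rescaledG (s + t) := by
  have h1 := rescaledG_mul s
  have h2 := rescaledG_mul t
  have h3 := rescaledG_mul (s + t)
  have n1 := rescale_exp_sub_one_ne_zero hs
  have n2 := rescale_exp_sub_one_ne_zero ht
  have n3 := rescale_exp_sub_one_ne_zero hst
  rw [← PowerSeries.exp_mul_exp_eq_exp_add] at h3 n3
  rw [map_add] at h3
  rw [map_mul]
  generalize PowerSeries.rescale s (PowerSeries.exp R) = u at *
  generalize PowerSeries.rescale t (PowerSeries.exp R) = v at *
  generalize rescaledG s = gs at *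
  generalize rescaledG t = gt at *
  generalize rescaledG (s + t) = g at *
  generalize PowerSeries.C s = s' at *
  generalize PowerSeries.C t = t' at *
  generalize (PowerSeries.X : PowerSeries R) = z at *
  have e : (t' * (gs * (g - gt)) + s' * (gt * (g - gs)) - z * (s' * t') * g) *
      ((u - 1) * (v - 1) * (u * v - 1)) = 0 := by
    -- Regrouped so that each `G` occurs only multiplied by its own denominator, ready for `h1`,
    -- `h2`, `h3`.
    have e1 : (t' * (gs * (g - gt)) + s' * (gt * (g - gs)) - z * (s' * t') * g) *
      ((u - 1) * (v - 1) * (u * v - 1)) =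
      t' * (gs * (u - 1)) * ((g * (u * v - 1)) * (v - 1) - (gt * (v - 1)) * (u * v - 1)) +
      s' * (gt * (v - 1)) * ((g * (u * v - 1)) * (u - 1) - (gs * (u - 1)) * (u * v - 1)) -
      z * (s' * t') * (g * (u * v - 1)) * (u - 1) * (v - 1) := by ring
    rw [e1, h1, h2, h3]
    ring
  have := (mul_eq_zero.1 e).resolve_right (mul_ne_zero (mul_ne_zero n1 n2) n3)
  exact sub_eq_zero.1 this

/-- This is the functional equation in degree `n + 1`; the factor `Z` on its right side lowers the
degree to `n`. For `p.2 = 0` the inner sums are empty, so the truncated subtraction is harmless. -/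
theorem sum_antidiagonal_tCoeff [IsDomain R] {s t : R} (hs : s ≠ 0) (ht : t ≠ 0)
    (hst : s + t ≠ 0) (n : ℕ) :
    ∑ p ∈ antidiagonal (n + 1), algebraMap ℚ R (tCoeff p.1) * algebraMap ℚ R (tCoeff p.2) *
      (s ^ p.1 * ∑ i ∈ range p.2, (s + t) ^ i * t ^ (p.2 - 1 - i) +
       t ^ p.1 * ∑ i ∈ range p.2, (s + t) ^ i * s ^ (p.2 - 1 - i)) =
      algebraMap ℚ R (tCoeff n) * (s + t) ^ n := by
  -- The factor `s * t` supplies `s = (s + t) - t` and `t = (s + t) - s`, which telescope the two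
  -- geometric sums.
  refine mul_left_cancel₀ (mul_ne_zero hs ht) ?_
  have h := congrArg (PowerSeries.coeff (n + 1)) (rescaledG_functional_equation hs ht hst)
  rw [mul_assoc PowerSeries.X, PowerSeries.coeff_succ_X_mul, map_add, PowerSeries.coeff_C_mul,
    PowerSeries.coeff_C_mul, PowerSeries.coeff_C_mul] at h
  simp only [PowerSeries.coeff_mul, map_sub, coeff_rescaledG] at h
  rw [Finset.mul_sum, Finset.mul_sum, ← Finset.sum_add_distrib] at h
  rw [Finset.mul_sum, mul_comm (algebraMap ℚ R _), ← h]
  refine Finset.sum_congr rfl fun p _ => ?_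
  have h1 := geom_sum₂_mul (s + t) t p.2
  have h2 := geom_sum₂_mul (s + t) s p.2
  rw [add_sub_cancel_right] at h1
  rw [add_sub_cancel_left] at h2
  linear_combination algebraMap ℚ R (tCoeff p.1) * algebraMap ℚ R (tCoeff p.2) *
    (t * s ^ p.1 * h1 + s * t ^ p.1 * h2)

end FunctionalEquation

/-! ### The fundamental action preserves brackets -/

section Fundamental

variable {K : Type*} [Field K] [CharZero K] {B : Type*} [LieRing B] [LieAlgebra K B]

/-- `d_{[a, b]} = [d_a, d_b]`. -/
theorem fundamentalSeries_lie (a b : B) :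
    fundamentalSeries K B ⁅a, b⁆ = ⁅fundamentalSeries K B a, fundamentalSeries K B b⁆ := by
  refine series_ext fun n y => ?_
  have halg : ∀ q : ℚ, algebraMap ℚ (MvPolynomial (Fin 2) K) q = C (q : K) := fun q => by
    rw [IsScalarTower.algebraMap_apply ℚ K (MvPolynomial (Fin 2) K), eq_ratCast,
      MvPolynomial.algebraMap_eq]
  -- Evaluation at `(1, 0)` shows that `S + T` is nonzero.
  have hst : (X 0 + X 1 : MvPolynomial (Fin 2) K) ≠ 0 := fun h => by
    simpa using congrArg (MvPolynomial.eval fun i => if i = 0 then (1 : K) else 0) h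
  have key := congrArg (lieEval y a b) (sum_antidiagonal_tCoeff
    (X_ne_zero (R := K) (0 : Fin 2)) (X_ne_zero 1) hst n)
  have hab : lieEval y a b (1 : MvPolynomial (Fin 2) K) = ⁅a, b⁆ := by
    simpa using lieEval_X_pow_mul_X_pow (K := K) y a b 0 0
  simp only [halg, ← smul_eq_C_mul, map_sum, map_smul, smul_mul_assoc] at key
  rw [← mul_one ((X 0 + X 1 : MvPolynomial (Fin 2) K) ^ n), lieEval_add_pow_mul, hab] at key
  have hl : (fundamentalSeries K B ⁅a, b⁆ n : B → B) y =
      (tCoeff n : K) • (LieAlgebra.ad K B y ^ n) ⁅a, b⁆ := rfl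
  rw [hl, ← key, lie_def, series_sub_apply, Submodule.coe_sub, Pi.sub_apply, formalDeriv_apply,
    formalDeriv_apply, ← Finset.sum_sub_distrib]
  refine Finset.sum_congr rfl fun p _ => ?_
  have e : ∀ (b : B) (k : ℕ), (fundamentalSeries K B b k : B → B) y =
      (tCoeff k : K) • ((LieAlgebra.ad K B y) ^ k) b := fun _ _ => rfl
  have e' : ∀ (b : B) (k : ℕ), fundamentalSeries K B b k = fundamentalComponent K B b k :=
    fun _ _ => rfl
  rw [e, e, e', e', polyDeriv_smul_right, polyDeriv_smul_right,
    polyDeriv_fundamentalComponent y _ b (lieEval y a b) (X 0 ^ p.1) (X 0 + X 1) (X 1)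
      (lieEval_add_mul y a b) (lieEval_X_pow_mul_X_pow y a b p.1),
    -- Here `b` is inserted into the series of `a`, so the brackets come in the opposite order; the
    -- code is `-lieEval`, whose sign cancels the minus of the bracket in `S(B)`.
    polyDeriv_fundamentalComponent y _ a (-lieEval y a b) (X 1 ^ p.1) (X 0 + X 1) (X 0)
      (fun P => by simp [lieEval_add_mul]) (fun j => by
        rw [mul_comm, LinearMap.neg_apply, lieEval_X_pow_mul_X_pow, lie_skew]),
    map_add, LinearMap.neg_apply, smul_neg, smul_neg, sub_neg_eq_add, smul_add, smul_add]

end Fundamental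

end FormalLie

theorem mainTheorem2 (K : Type*) [Field K] [CharZero K] (B : Type*) [LieRing B] [LieAlgebra K B] :
    ∃ d : FormalLie.FormalAction K B B,
      (d : B →ₗ[K] FormalLie.S K B) = FormalLie.fundamentalAction K B :=
  ⟨{ FormalLie.fundamentalAction K B with
      map_lie' := fun {a b} => FormalLie.fundamentalSeries_lie a b }, rfl⟩
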